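/- Let $m,n\ge 0$ be integers. For points $x_0,\dots,x_{m+1}\in\mathbb R^n$ let $\triangle(x_0,\dots,x_{m+1})$ denote their convex hull and define the discrete curvature $$\mathcal K(x_0,\dots,x_{m+1})=\frac{\mathcal H^{m+1}(\triangle(x_0,\dots,x_{m+1}))}{(\operatorname{diam}\{x_0,\dots,x_{m+1}\})^{m+2}},$$ with $\mathcal K=0$ if all the points coincide. Here $\mathcal H^k$ is the $k$-dimensional Hausdorff measure, normalised to agree with Lebesgue measure on $\mathbb R^k$. For $\Sigma\subseteq\mathbb R^n$, $p>0$ and $l\in\{1,\dots,m+2\}$ set $$\mathcal E_p^l(\Sigma)=\int_{\Sigma^l}\ \sup_{x_l,\dots,x_{m+1}\in\Sigma}\mathcal K(x_0,\dots,x_{m+1})^p\ d\mathcal H^{ml}_{(x_0,\dots,x_{l-1})}$$ (no supremum if $l=m+2$), where $\Sigma^l\subseteq(\mathbb R^n)^l=\mathbb R^{nl}$ with its Euclidean metric. Let $M\subseteq\mathbb R^n$ be a compact embedded $m$-dimensional submanifold (without boundary) of class $C^2$. Then $\mathcal K$ is bounded on $M^{m+2}$, that is, there is a constant $C<\infty$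 with $\mathcal K(x_0,\dots,x_{m+1})\le C$ for all $x_0,\dots,x_{m+1}\in M$. Therefore $\mathcal E_p^l(M)<\infty$ for every $p>0$ and every $l\in\{1,\dots,m+2\}$. -/

import Mathlib

open scoped ENNReal NNReal MeasureTheory Manifold

/-- The discrete curvature of `m + 2` points of `ℝⁿ`: the `(m+1)`-dimensional Hausdorff measure
(normalised to agree with Lebesgue measure on `ℝ^(m+1)`) of the simplex spanned by the points,
divided by the `(m+2)`-nd power of the diameter of the set of points. In `ℝ≥0∞` one has `0 / 0 = 0`,
so the curvature of `m + 2` coinciding points is `0`. -/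
noncomputable def discreteCurvature {n : ℕ} (m : ℕ)
    (x : Fin (m + 2) → EuclideanSpace ℝ (Fin n)) : ℝ≥0∞ :=
  μHE[m + 1] (convexHull ℝ (Set.range x)) / Metric.ediam (Set.range x) ^ (m + 2)

/-- The energy `ℰ_p^l(S)` of a set `S ⊆ ℝⁿ`: the integral over `S^l ⊆ (ℝⁿ)^l = ℝ^(nl)` (with the
Euclidean metric), with respect to the `(ml)`-dimensional Hausdorff measure, of the supremum of the
`p`-th power of the curvature over all `(m+2)`-tuples of points of `S` whose first `l` entries are
the given ones. -/
noncomputable def curvatureEnergy {n : ℕ} (m l : ℕ) (hl : l ≤ m + 2) (p : ℝ)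
    (S : Set (EuclideanSpace ℝ (Fin n))) : ℝ≥0∞ :=
  ∫⁻ x in {x : PiLp 2 (fun _ : Fin l => EuclideanSpace ℝ (Fin n)) | ∀ i, x i ∈ S},
    (⨆ (z : Fin (m + 2) → EuclideanSpace ℝ (Fin n)) (_ : ∀ j, z j ∈ S)
      (_ : ∀ i : Fin l, z (Fin.castLE hl i) = x i), discreteCurvature m z ^ p) ∂μHE[m * l]

open Topology MeasureTheory Module

/-! By Taylor's formula and compactness there is one constant `C` such that, for each `x` in `M`,
every `y` in `M` lies within `C‖y - x‖²` of an `m`-plane through `x`. Hence a simplex with vertices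
in `M` and diameter `d` fits in an `(m+1)`-dimensional box with one side `2Cd²` and `m` sides `2d`.
Its volume is at most a constant times `d^(m+2)`, which is exactly the denominator of the curvature.

The energies then integrate a bounded function over a set of finite measure: `M^l` is compact and
locally a Lipschitz image of a bounded set in `ℝ^(ml)`. -/

/-- A `C²` map is, near a point, Lipschitz and approximated to second order by its derivative. -/
theorem ContDiffAt.exists_lipschitzOnWith_and_quadratic_approx {E F : Type*}
    [NormedAddCommGroup E] [NormedSpace ℝ E] [NormedAddCommGroup F] [NormedSpace ℝ F]
    {f : E → F} {a : E} (hf : ContDiffAt ℝ 2 f a) :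
    ∃ r > 0, ∃ K C : ℝ≥0, LipschitzOnWith K f (Metric.ball a r) ∧
      ∀ u ∈ Metric.ball a r, ∀ v ∈ Metric.ball a r,
        ‖f v - f u - fderiv ℝ f u (v - u)‖ ≤ C * ‖v - u‖ ^ 2 := by
  obtain ⟨K, s, hs, hK⟩ := (hf.of_le (by norm_num)).exists_lipschitzOnWith
  obtain ⟨C, t, ht, hC⟩ :=
    (hf.fderiv_right (m := 1) (by norm_num)).exists_lipschitzOnWith
  have hd : ∀ᶠ x in 𝓝 a, DifferentiableAt ℝ f x :=
    (hf.eventually (by simp)).mono fun x hx => hx.differentiableAt (by norm_num)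
  obtain ⟨r, hr, hball⟩ :=
    Metric.mem_nhds_iff.1 (Filter.inter_mem (Filter.inter_mem hs ht) hd)
  refine ⟨r, hr, K, C, hK.mono fun x hx => (hball hx).1.1, fun u hu v hv => ?_⟩
  have hseg : segment ℝ u v ⊆ Metric.ball a r := (convex_ball a r).segment_subset hu hv
  -- Mean value inequality: on the segment the derivative differs from `fderiv ℝ f u` by at most `C
  -- * ‖v - u‖`.
  have := (convex_segment u v).norm_image_sub_le_of_norm_hasFDerivWithin_le' (f := f)
    (f' := fderiv ℝ f) (φ := fderiv ℝ f u) (C := C * ‖v - u‖)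
    (fun x hx => (hball (hseg hx)).2.hasFDerivAt.hasFDerivWithinAt)
    (fun x hx => ?_) (left_mem_segment ℝ u v) (right_mem_segment ℝ u v)
  · rwa [mul_assoc, ← sq] at this
  · refine (hC.norm_sub_le (hball (hseg hx)).1.2 (hball hu).1.2).trans ?_
    gcongr
    obtain ⟨c, hc, rfl⟩ := segment_eq_image' ℝ u v ▸ hx
    rw [add_sub_cancel_left, norm_smul, Real.norm_of_nonneg hc.1]
    exact mul_le_of_le_one_left (norm_nonneg _) hc.2

/-- Near each of its points, an embedded submanifold of `ℝⁿ` has a `C²` parametrisation whose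
inverse is the restriction of a `C²` map of the ambient space. -/
theorem Manifold.IsSmoothEmbedding.exists_contDiffAt_param {n m : ℕ}
    {M : Set (EuclideanSpace ℝ (Fin n))} [ChartedSpace (EuclideanSpace ℝ (Fin m)) M]
    [IsManifold (𝓡 m) 2 M]
    (hemb : IsSmoothEmbedding (𝓡 m) (𝓡 n) 2 (Subtype.val : M → EuclideanSpace ℝ (Fin n)))
    {p : EuclideanSpace ℝ (Fin n)} (hp : p ∈ M) :
    ∃ (f : EuclideanSpace ℝ (Fin m) → EuclideanSpace ℝ (Fin n))
      (g : EuclideanSpace ℝ (Fin n) → EuclideanSpace ℝ (Fin m)),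
      ContDiffAt ℝ 2 f (g p) ∧ ContDiffAt ℝ 2 g p ∧ ∀ᶠ x in 𝓝[M] p, f (g x) = x := by
  have h := hemb.isImmersion.isImmersionOfComplement_complement ⟨p, hp⟩
  -- In adapted charts an immersion reads `u ↦ (u, 0)`, so the first component of the ambient chart
  -- extends the chart of `M`.
  have hg : ∀ x : M, x ∈ h.domChart.source →
      (h.equiv.symm (h.codChart x)).1 = h.domChart x := by
    intro x hx
    have hmem : h.domChart x ∈ (h.domChart.extend (𝓡 m)).target := by
      simpa using h.domChart.map_source hx
    have := h.writtenInCharts hmem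
    simp [h.domChart.left_inv hx] at this
    rw [this]; simp
  refine ⟨fun u => (h.domChart.symm u : M), fun x => (h.equiv.symm (h.codChart x)).1, ?_, ?_, ?_⟩
  · beta_reduce
    rw [hg ⟨p, hp⟩ h.mem_domChart_source, ← contMDiffAt_iff_contDiffAt]
    have h1 := contMDiffAt_symm_of_mem_maximalAtlas h.domChart_mem_maximalAtlas
      (h.domChart.map_source h.mem_domChart_source)
    exact (hemb.contMDiff _).comp _ h1
  · have h1 := contMDiffAt_of_mem_maximalAtlas h.codChart_mem_maximalAtlas h.mem_codChart_source
    rw [contMDiffAt_iff_contDiffAt] at h1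
    exact contDiffAt_fst.comp _ (h.equiv.symm.contDiff.contDiffAt.comp _ h1)
  · rw [← map_nhds_subtype_val ⟨p, hp⟩, Filter.eventually_map]
    filter_upwards [h.domChart.open_source.mem_nhds h.mem_domChart_source] with x hx
    rw [hg x hx, h.domChart.left_inv hx]

theorem EuclideanSpace.volume_setOf_abs_le {ι : Type*} [Fintype ι] (r : ι → ℝ) :
    volume {u : EuclideanSpace ℝ ι | ∀ i, |u i| ≤ r i} = ∏ i, ENNReal.ofReal (2 * r i) := by
  have h : {u : EuclideanSpace ℝ ι | ∀ i, |u i| ≤ r i} =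
      WithLp.ofLp ⁻¹' (Set.Icc (fun i => -r i) r) := by
    ext u
    simp [abs_le, Pi.le_def, forall_and]
  rw [h, (PiLp.volume_preserving_ofLp ι).measure_preimage measurableSet_Icc.nullMeasurableSet,
    Real.volume_Icc_pi]
  simp [two_mul]

/-! ### Volume of thin simplices -/

section

variable {E : Type*} [NormedAddCommGroup E] [InnerProductSpace ℝ E] [MeasurableSpace E]
  [BorelSpace E]

/-- The part of a translate of a subspace of dimension `< k` in a ball is `μHE[k]`-null. -/
theorem euclideanHausdorffMeasure_eq_zero_of_subset {k : ℕ} {W : Submodule ℝ E}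
    [FiniteDimensional ℝ W] (hW : finrank ℝ W < k) {S : Set E} (a : E) (d : ℝ)
    (hS : ∀ z ∈ S, z - a ∈ W ∧ ‖z - a‖ ≤ d) : μHE[k] S = 0 := by
  have hj : Isometry fun w : W => a + (w : E) :=
    (IsometryEquiv.addLeft a).isometry.comp isometry_subtype_coe
  have hsub : S ⊆ (fun w : W => a + (w : E)) '' Metric.closedBall 0 d := fun z hz =>
    ⟨⟨z - a, (hS z hz).1⟩, by simpa using (hS z hz).2, by simp⟩
  refine measure_mono_null hsub ?_
  rw [hj.euclideanHausdorffMeasure_image]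
  -- Finite measure in dimension `finrank ℝ W` forces measure zero in any higher dimension.
  refine (Measure.euclideanHausdorffMeasure_zero_or_top hW _).resolve_right ?_
  exact (isCompact_closedBall (0 : W) d).measure_lt_top.ne

/-- If the differences `x i - x 0` lie within `δ` of a subspace of dimension at most `m`, then the
simplex with vertices `x 0, …, x (m + 1)` has small volume. -/
theorem euclideanHausdorffMeasure_convexHull_le [FiniteDimensional ℝ E] {m : ℕ}
    (x : Fin (m + 2) → E) {V : Submodule ℝ E}
    (hV : finrank ℝ V ≤ m) {d δ : ℝ} (hd : ∀ i, ‖x i - x 0‖ ≤ d)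
    (hδ : ∀ i, ∃ v ∈ V, ‖x i - x 0 - v‖ ≤ δ) :
    μHE[m + 1] (convexHull ℝ (Set.range x)) ≤
      ENNReal.ofReal (2 * δ) * ENNReal.ofReal (2 * d) ^ m := by
  set W : Submodule ℝ E := Submodule.span ℝ (Set.range fun i : Fin (m + 1) => x i.succ - x 0)
  have hxW : ∀ i, x i - x 0 ∈ W := by
    refine Fin.cases (by simp) fun i => Submodule.subset_span ⟨i, rfl⟩
  have hW : finrank ℝ W ≤ m + 1 := by
    simpa [Set.finrank] using finrank_range_le_card (R := ℝ) fun i : Fin (m + 1) => x i.succ - x 0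
  rcases hW.lt_or_eq with hlt | heq
  · rw [euclideanHausdorffMeasure_eq_zero_of_subset hlt (x 0) d]
    · exact zero_le
    · intro z hz
      let T : Set E := {z | z - x 0 ∈ W ∧ ‖z - x 0‖ ≤ d}
      have hT : Convex ℝ T := by
        have : T = (AffineMap.id ℝ E - AffineMap.const ℝ E (x 0)) ⁻¹'
            ((W : Set E) ∩ Metric.closedBall 0 d) := by ext; simp [T]
        rw [this]
        exact (W.convex.inter (convex_closedBall 0 d)).affine_preimage _
      exact convexHull_min (by rintro _ ⟨i, rfl⟩; exact ⟨hxW i, hd i⟩) hT hz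
  -- The thin direction `w`: since `dim W > dim V`, `W` meets `Vᗮ` nontrivially.
  · obtain ⟨w, hwW, hwV, hw⟩ : ∃ w ∈ W, w ∈ Vᗮ ∧ ‖w‖ = 1 := by
      have hne : W ⊓ Vᗮ ≠ ⊥ := fun h => by
        have h1 := Submodule.finrank_add_finrank_le_of_disjoint (disjoint_iff.2 h)
        have h2 := Submodule.finrank_add_finrank_orthogonal V
        omega
      obtain ⟨w, hw, hw0⟩ := Submodule.exists_mem_ne_zero_of_ne_bot hne
      have := norm_ne_zero_iff.2 hw0
      exact ⟨‖w‖⁻¹ • w, W.smul_mem _ hw.1, Vᗮ.smul_mem _ hw.2, by simp [norm_smul, this]⟩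
    obtain ⟨b, hb⟩ := Orthonormal.exists_orthonormalBasis_extension_of_card_eq (𝕜 := ℝ) (E := W)
      (ι := Fin (m + 1)) (by simpa using heq) (v := fun _ => ⟨w, hwW⟩) (s := {0}) (by
        refine ⟨fun i => by simpa using hw, fun i j hij => (hij (Subsingleton.elim _ _)).elim⟩)
    replace hb : (b 0 : E) = w := by rw [hb 0 rfl]
    let r : Fin (m + 1) → ℝ := Fin.cons δ fun _ => d
    let B : Set (EuclideanSpace ℝ (Fin (m + 1))) := {u | ∀ i, |u i| ≤ r i}
    let j : EuclideanSpace ℝ (Fin (m + 1)) →ₗ[ℝ] E := W.subtype ∘ₗ b.repr.symm.toLinearMap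
    have hjiso : Isometry fun u => x 0 + j u :=
      (IsometryEquiv.addLeft (x 0)).isometry.comp
        (isometry_subtype_coe.comp b.repr.symm.isometry)
    have hBconv : Convex ℝ B := by
      have : B = WithLp.linearEquiv 2 ℝ (Fin (m + 1) → ℝ) ⁻¹' (Set.Icc (fun i => -r i) r) := by
        ext u
        simp [B, abs_le, Pi.le_def, forall_and]
      rw [this]
      exact (convex_Icc _ _).linear_preimage (WithLp.linearEquiv 2 ℝ (Fin (m + 1) → ℝ)).toLinearMap
    have hsub : convexHull ℝ (Set.range x) ⊆ (fun u => x 0 + j u) '' B := by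
      refine convexHull_min ?_ ?_
      · rintro _ ⟨i, rfl⟩
        refine ⟨b.repr ⟨x i - x 0, hxW i⟩, ?_, by simp [j]⟩
        refine Fin.cases ?_ fun k => ?_
        · obtain ⟨v, hv, hvδ⟩ := hδ i
          simp only [b.repr_apply_apply, Submodule.coe_inner, hb, r, Fin.cons_zero]
          have h0 : inner ℝ w v = 0 := by
            rw [real_inner_comm]; exact Submodule.inner_right_of_mem_orthogonal hv hwV
          calc |inner ℝ w (x i - x 0)| = |inner ℝ w (x i - x 0 - v)| := by
                rw [inner_sub_right _ _ v, h0, sub_zero]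
            _ ≤ ‖w‖ * ‖x i - x 0 - v‖ := abs_real_inner_le_norm _ _
            _ ≤ δ := by rwa [hw, one_mul]
        · simp only [b.repr_apply_apply, r, Fin.cons_succ]
          refine (abs_real_inner_le_norm _ _).trans ?_
          rw [b.orthonormal.1, one_mul]
          exact hd i
      · have := (hBconv.linear_image j).vadd (x 0)
        rwa [← Set.image_vadd, Set.image_image] at this
    refine (measure_mono hsub).trans_eq ?_
    rw [hjiso.euclideanHausdorffMeasure_image, EuclideanSpace.euclideanHausdorffMeasure_eq_volume,
      EuclideanSpace.volume_setOf_abs_le, Fin.prod_univ_succ]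
    simp [r]

end

theorem LipschitzOnWith.euclideanHausdorffMeasure_image_le {X Y : Type*} [EMetricSpace X]
    [MeasurableSpace X] [BorelSpace X] [EMetricSpace Y] [MeasurableSpace Y] [BorelSpace Y]
    {K : ℝ≥0} {f : X → Y} {s : Set X} (hf : LipschitzOnWith K f s) (d : ℕ) :
    μHE[d] (f '' s) ≤ (K : ℝ≥0∞) ^ d * μHE[d] s := by
  simp only [Measure.euclideanHausdorffMeasure_def, Measure.smul_apply, ENNReal.smul_def,
    smul_eq_mul]
  rw [mul_left_comm]
  gcongr
  simpa using hf.hausdorffMeasure_image_le d.cast_nonneg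

/-! ### Compact submanifolds -/

section

variable {n m : ℕ} {M : Set (EuclideanSpace ℝ (Fin n))}
  [ChartedSpace (EuclideanSpace ℝ (Fin m)) M] [IsManifold (𝓡 m) 2 M]

namespace Manifold.IsSmoothEmbedding

/-- The powers of a compact embedded submanifold have finite Hausdorff measure. -/
theorem euclideanHausdorffMeasure_pow_lt_top
    (hemb : IsSmoothEmbedding (𝓡 m) (𝓡 n) 2 (Subtype.val : M → EuclideanSpace ℝ (Fin n)))
    (hM : IsCompact M) (l : ℕ) :
    μHE[m * l] {x : PiLp 2 (fun _ : Fin l => EuclideanSpace ℝ (Fin n)) | ∀ i, x i ∈ M} < ∞ := by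
  have hcomp : IsCompact
      {x : PiLp 2 (fun _ : Fin l => EuclideanSpace ℝ (Fin n)) | ∀ i, x i ∈ M} := by
    convert (isCompact_univ_pi fun _ : Fin l => hM).image
      (PiLp.continuous_toLp 2 fun _ : Fin l => EuclideanSpace ℝ (Fin n)) using 1
    ext x
    simp only [Set.mem_ofPred_eq, Set.mem_image, Set.mem_univ_pi]
    exact ⟨fun h => ⟨x.ofLp, h, rfl⟩, by rintro ⟨y, hy, rfl⟩; exact hy⟩
  refine hcomp.measure_lt_top_of_nhdsWithin fun x hx => ?_
  choose f g hf hg hfg using fun i => hemb.exists_contDiffAt_param (hx i)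
  let F : PiLp 2 (fun _ : Fin l => EuclideanSpace ℝ (Fin m)) →
      PiLp 2 (fun _ : Fin l => EuclideanSpace ℝ (Fin n)) :=
    fun u => WithLp.toLp 2 fun i => f i (u i)
  let G : PiLp 2 (fun _ : Fin l => EuclideanSpace ℝ (Fin n)) →
      PiLp 2 (fun _ : Fin l => EuclideanSpace ℝ (Fin m)) :=
    fun y => WithLp.toLp 2 fun i => g i (y i)
  have hF : ContDiffAt ℝ 1 F (G x) := by
    rw [contDiffAt_piLp]
    intro i
    exact ((hf i).of_le (by norm_num)).comp (G x)
      ((PiLp.proj 2 (fun _ : Fin l => EuclideanSpace ℝ (Fin m)) i :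
        _ →L[ℝ] _).contDiff.contDiffAt)
  have hG : ContinuousAt G x := by
    refine (PiLp.continuous_toLp 2 _).continuousAt.comp (continuousAt_pi.2 fun i => ?_)
    exact (hg i).continuousAt.comp (f := fun y : PiLp 2 _ => y i)
      (PiLp.continuous_apply 2 _ i).continuousAt
  obtain ⟨K, t, ht, hK⟩ := hF.exists_lipschitzOnWith
  have hrank : finrank ℝ (PiLp 2 (fun _ : Fin l => EuclideanSpace ℝ (Fin m))) = m * l := by
    rw [(WithLp.linearEquiv 2 ℝ (Fin l → EuclideanSpace ℝ (Fin m))).finrank_eq,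
      finrank_pi_fintype]
    simp [mul_comm]
  -- The ball bounds the domain, so that it has finite volume.
  set t' := t ∩ Metric.closedBall (G x) 1
  have ht' : t' ∈ 𝓝 (G x) := Filter.inter_mem ht (Metric.closedBall_mem_nhds _ one_pos)
  have hfin : μHE[m * l] (F '' t') < ∞ := by
    refine ((hK.mono Set.inter_subset_left).euclideanHausdorffMeasure_image_le _).trans_lt ?_
    refine ENNReal.mul_lt_top (by simp) ?_
    rw [← hrank]
    exact (measure_mono Set.inter_subset_right).trans_lt
      (isCompact_closedBall (G x) 1).measure_lt_top
  have hev : ∀ᶠ y in 𝓝[{x : PiLp 2 (fun _ : Fin l => EuclideanSpace ℝ (Fin n)) |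
      ∀ i, x i ∈ M}] x, ∀ i, f i (g i (y i)) = y i := by
    refine Filter.eventually_all.2 fun i => ?_
    refine Filter.Tendsto.eventually (f := fun y : PiLp 2 fun _ : Fin l =>
      EuclideanSpace ℝ (Fin n) => y i) (l₂ := 𝓝[M] x i) ?_ (hfg i)
    exact tendsto_nhdsWithin_of_tendsto_nhds_of_eventually_within _
      ((PiLp.continuous_apply 2 _ i).tendsto x |>.mono_left nhdsWithin_le_nhds)
      (eventually_mem_nhdsWithin.mono fun y hy => hy i)
  refine ⟨_, ?_, hfin⟩
  filter_upwards [hev, nhdsWithin_le_nhds (hG ht')] with y hy hyt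
  exact ⟨G y, hyt, by ext1 i; exact hy i⟩

/-- A compact embedded `C²` submanifold lies quadratically close to its tangent planes. -/
theorem exists_quadratic_approx
    (hemb : IsSmoothEmbedding (𝓡 m) (𝓡 n) 2 (Subtype.val : M → EuclideanSpace ℝ (Fin n)))
    (hM : IsCompact M) :
    ∃ C : ℝ≥0, ∀ x ∈ M, ∃ V : Submodule ℝ (EuclideanSpace ℝ (Fin n)), finrank ℝ V ≤ m ∧
      ∀ y ∈ M, ∃ v ∈ V, ‖y - x - v‖ ≤ C * ‖y - x‖ ^ 2 := by
  refine hM.induction_on (p := fun S => ∃ C : ℝ≥0, ∀ x ∈ S,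
    ∃ V : Submodule ℝ (EuclideanSpace ℝ (Fin n)), finrank ℝ V ≤ m ∧
      ∀ y ∈ M, ∃ v ∈ V, ‖y - x - v‖ ≤ C * ‖y - x‖ ^ 2) ⟨0, by simp⟩
    (fun S T hST ⟨C, hC⟩ => ⟨C, fun x hx => hC x (hST hx)⟩) ?_ ?_
  · rintro S T ⟨C, hC⟩ ⟨D, hD⟩
    refine ⟨max C D, ?_⟩
    rintro x (hx | hx)
    · obtain ⟨V, hV, h⟩ := hC x hx
      refine ⟨V, hV, fun y hy => ?_⟩
      obtain ⟨v, hv, hvy⟩ := h y hy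
      exact ⟨v, hv, hvy.trans (by gcongr; exact le_max_left _ _)⟩
    · obtain ⟨V, hV, h⟩ := hD x hx
      refine ⟨V, hV, fun y hy => ?_⟩
      obtain ⟨v, hv, hvy⟩ := h y hy
      exact ⟨v, hv, hvy.trans (by gcongr; exact le_max_right _ _)⟩
  · intro p hp
    obtain ⟨f, g, hf, hg, hfg⟩ := hemb.exists_contDiffAt_param hp
    obtain ⟨r, hr, -, C, -, hC⟩ := hf.exists_lipschitzOnWith_and_quadratic_approx
    obtain ⟨K, t, ht, hK⟩ := (hg.of_le (by norm_num)).exists_lipschitzOnWith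
    obtain ⟨ε, hε, hball⟩ := Metric.mem_nhdsWithin_iff.1 (Filter.inter_mem hfg
      (nhdsWithin_le_nhds (Filter.inter_mem ht (hg.continuousAt (Metric.ball_mem_nhds _ hr)))))
    -- Halving the radius puts any `y` outside the `ε`-ball at distance at least `ε / 2` from `x`;
    -- there `v = 0` works with constant `2 / ε`.
    refine ⟨M ∩ Metric.ball p (ε / 2), Filter.inter_mem self_mem_nhdsWithin
      (nhdsWithin_le_nhds (Metric.ball_mem_nhds _ (by positivity))),
      max (C * K ^ 2) (2 / ε).toNNReal, ?_⟩
    rintro x ⟨hxM, hxp⟩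
    obtain ⟨hx1, hx2, hx3⟩ := hball ⟨Metric.ball_subset_ball (by linarith) hxp, hxM⟩
    refine ⟨LinearMap.range (fderiv ℝ f (g x)).toLinearMap,
      (LinearMap.finrank_range_le _).trans (by simp), fun y hy => ?_⟩
    by_cases hyp : dist y p < ε
    · obtain ⟨hy1, hy2, hy3⟩ := hball ⟨hyp, hy⟩
      refine ⟨fderiv ℝ f (g x) (g y - g x), ⟨_, rfl⟩, ?_⟩
      have h1 := hC _ hx3 _ hy3
      rw [show f (g x) = x from hx1, show f (g y) = y from hy1] at h1
      calc _ ≤ (C : ℝ) * ‖g y - g x‖ ^ 2 := h1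
        _ ≤ C * (K * ‖y - x‖) ^ 2 := by gcongr; exact hK.norm_sub_le hy2 hx2
        _ = (C * K ^ 2 : ℝ≥0) * ‖y - x‖ ^ 2 := by push_cast; ring
        _ ≤ _ := by gcongr; exact le_max_left _ _
    · refine ⟨0, zero_mem _, ?_⟩
      have h1 : ε / 2 ≤ ‖y - x‖ := by
        rw [← dist_eq_norm]
        have := dist_triangle y x p
        have := Metric.mem_ball.1 hxp
        linarith
      calc ‖y - x - 0‖ = (2 / ε) * (ε / 2) * ‖y - x‖ := by rw [sub_zero]; field_simp
        _ ≤ (2 / ε) * ‖y - x‖ * ‖y - x‖ := by gcongr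
        _ = (2 / ε).toNNReal * ‖y - x‖ ^ 2 := by
          rw [Real.coe_toNNReal _ (by positivity)]; ring
        _ ≤ _ := by gcongr; exact le_max_right _ _

/-- The discrete curvature is bounded on a compact embedded `C²` submanifold. -/
theorem exists_discreteCurvature_le
    (hemb : IsSmoothEmbedding (𝓡 m) (𝓡 n) 2 (Subtype.val : M → EuclideanSpace ℝ (Fin n)))
    (hM : IsCompact M) :
    ∃ C : ℝ≥0, ∀ x : Fin (m + 2) → EuclideanSpace ℝ (Fin n),
      (∀ i, x i ∈ M) → discreteCurvature m x ≤ C := by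
  obtain ⟨C, hC⟩ := hemb.exists_quadratic_approx hM
  refine ⟨2 * C * 2 ^ m, fun x hx => ?_⟩
  obtain ⟨V, hV, hVx⟩ := hC _ (hx 0)
  have hbdd : Bornology.IsBounded (Set.range x) := (Set.finite_range x).isBounded
  set d := Metric.diam (Set.range x)
  have hd : ∀ i, ‖x i - x 0‖ ≤ d := fun i => by
    rw [← dist_eq_norm]
    exact Metric.dist_le_diam_of_mem hbdd ⟨i, rfl⟩ ⟨0, rfl⟩
  have hvol := euclideanHausdorffMeasure_convexHull_le x hV hd (δ := C * d ^ 2) fun i => by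
    obtain ⟨v, hv, h⟩ := hVx _ (hx i)
    exact ⟨v, hv, h.trans (by gcongr; exact hd i)⟩
  have hdiam : Metric.ediam (Set.range x) = ENNReal.ofReal d :=
    (ENNReal.ofReal_toReal hbdd.ediam_ne_top).symm
  -- This needs no `d ≠ 0`: for coinciding points both sides of the volume bound vanish.
  refine ENNReal.div_le_of_le_mul (hvol.trans_eq ?_)
  rw [hdiam]
  lift d to ℝ≥0 using Metric.diam_nonneg with e
  rw [show 2 * ((C : ℝ) * (e : ℝ) ^ 2) = ((2 * (C * e ^ 2) : ℝ≥0) : ℝ) by push_cast; rfl,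
    show 2 * (e : ℝ) = ((2 * e : ℝ≥0) : ℝ) by push_cast; rfl]
  simp only [ENNReal.ofReal_coe_nnreal]
  norm_cast
  push_cast
  ring

end Manifold.IsSmoothEmbedding

end

theorem mainTheorem7 (n m : ℕ) (M : Set (EuclideanSpace ℝ (Fin n))) (hM : IsCompact M)
    [ChartedSpace (EuclideanSpace ℝ (Fin m)) M] [IsManifold (𝓡 m) 2 M]
    (hemb : Manifold.IsSmoothEmbedding (𝓡 m) (𝓡 n) 2 (Subtype.val : M → EuclideanSpace ℝ (Fin n))) :
    (∃ C : ℝ≥0, ∀ x : Fin (m + 2) → EuclideanSpace ℝ (Fin n),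
      (∀ i, x i ∈ M) → discreteCurvature m x ≤ C) ∧
    ∀ p : ℝ, 0 < p → ∀ (l : ℕ) (_ : 1 ≤ l) (hl : l ≤ m + 2),
      curvatureEnergy m l hl p M < ∞ := by
  obtain ⟨C, hC⟩ := hemb.exists_discreteCurvature_le hM
  refine ⟨⟨C, hC⟩, fun p hp l _ hl => ?_⟩
  calc curvatureEnergy m l hl p M
      ≤ ∫⁻ _ in {x : PiLp 2 (fun _ : Fin l => EuclideanSpace ℝ (Fin n)) | ∀ i, x i ∈ M},
        (C : ℝ≥0∞) ^ p ∂μHE[m * l] := lintegral_mono fun x => iSup_le fun z => iSup_le fun hz =>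
          iSup_le fun _ => ENNReal.rpow_le_rpow (hC z hz) hp.le
    _ = (C : ℝ≥0∞) ^ p *
        μHE[m * l] {x : PiLp 2 (fun _ : Fin l => EuclideanSpace ℝ (Fin n)) | ∀ i, x i ∈ M} := by
      rw [setLIntegral_const]
    _ < ∞ := ENNReal.mul_lt_top (ENNReal.rpow_lt_top_of_nonneg hp.le ENNReal.coe_ne_top)
      (hemb.euclideanHausdorffMeasure_pow_lt_top hM l)
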